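/- **Notation.** Let $n\ge 1$. A cube in $\mathbb{R}^n$ is a closed nondegenerate cube with sides parallel to the axes, $|\cdot|$ is Lebesgue measure, and two cubes are nonoverlapping if their interiors are disjoint. For a cube $Q_0$, $\mathcal{D}(Q_0)$ is the family of dyadic subcubes of $Q_0$, i.e. those formed from $Q_0$ (itself included) by repeated subdivision into $2^n$ congruent subcubes; $\widehat{Q}$ is the dyadic parent of a $Q\in\mathcal{D}(Q_0)$ with $Q\ne Q_0$, i.e. the cube of $\mathcal{D}(Q_0)$ whose subdivision produced $Q$. For a cube $Q$, a real-valued measurable function $f$ on $Q$, and $0<t<1$, the (maximal) median is $$m_f(t,Q)=\sup\{M\in\mathbb{R}: |\{y\in Q: f(y)<M\}|\le t|Q|\}.$$ For a cube $Q_0$, $0<s\le 1/2$ and $x\in Q_0$, the local sharp maximal function restricted to $Q_0$ is $$M^{\sharp}_{0,s,Q_0}f(x)=\sup_{x\in Q,\;Q\subset Q_0}\ \inf_{c\in\mathbb{R}}\ \inf\{\alpha\ge 0: |\{y\in Q:|f(y)-c|>\alpha\}|<s|Q|\}\in[0,\infty],$$ where the supremum is over all cubes $Q\subset Q_0$ containing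 $x$. **Theorem (first local median oscillation decomposition).** Let $f$ be a real-valued measurable function on a cube $Q_0\subset\mathbb{R}^n$, $0<s<1/2$, and $1/2\le t<1-s$. Then there exist, for each $v=1,2,3,\dots$, a (possibly empty) collection $\{Q^v_j\}_j\subset\mathcal{D}(Q_0)\setminus\{Q_0\}$ and a set $I^v_2$ of indices $j$ of this collection, such that (i) for a.e. $x\in Q_0$, $$|f(x)-m_f(t,Q_0)|\le 4M^{\sharp}_{0,s,Q_0}f(x)+\sum_{v=1}^{\infty}\sum_{j\in I^v_2}\Big(10n\inf_{y\in Q^v_j}M^{\sharp}_{0,s,\widehat{Q^v_j}}f(y)+2\inf_{y\in Q^v_j}M^{\sharp}_{0,s,Q^v_j}f(y)\Big)\mathbf{1}_{Q^v_j}(x);$$ (ii) for each fixed $v$, the cubes $Q^v_j$ are nonoverlapping; (iii) if $\Omega^v=\bigcup_j Q^v_j$, then $\Omega^{v+1}\subset\Omega^v$ for all $v\ge 1$; and (iv) $|\Omega^{v+1}\cap Q^v_j|\le\frac{s}{1-t}|Q^v_j|$ for all $v\ge1$ and all $j$. -/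

import Mathlib

open MeasureTheory Set
open scoped ENNReal NNReal

/-- A (nondegenerate, closed) cube in `ℝⁿ` with sides parallel to the axes, given by its lower
corner and its side length. -/
structure Cube (n : ℕ) where
  corner : Fin n → ℝ
  side : ℝ
  side_pos : 0 < side

namespace Cube

variable {n : ℕ}

/-- The set of points `y` with `corner i ≤ y i ≤ corner i + side` for all `i`. -/
def toSet (Q : Cube n) : Set (Fin n → ℝ) :=
  Set.Icc Q.corner (fun i => Q.corner i + Q.side)

/-- The `2ⁿ` congruent subcubes obtained from `Q` by halving every side; in the `i`-th coordinate,
`ε i` chooses between the lower half and the upper half. -/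
noncomputable def child (Q : Cube n) (ε : Fin n → Bool) : Cube n where
  corner := fun i => Q.corner i + if ε i then Q.side / 2 else 0
  side := Q.side / 2
  side_pos := half_pos Q.side_pos

/-- The dyadic subcubes relative to `Q₀`, that is, the cubes formed by repeated subdivision of
`Q₀`. Each is named by the word of choices made in its construction, the latest choice coming
first. So the empty word names `Q₀` itself, and if `w ≠ []` then `w.tail` names the dyadic parent
of the cube named by `w`. -/
noncomputable def dyadic (Q₀ : Cube n) : List (Fin n → Bool) → Cube n
  | [] => Q₀
  | ε :: w => (dyadic Q₀ w).child ε

end Cube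

/-- The (maximal) median `m_f(t, Q) = sup {M : |{y ∈ Q : f y < M}| ≤ t |Q|}`. For `0 < t < 1` and
real-valued `f` measurable on `Q`, the set is nonempty and bounded above. -/
noncomputable def median {n : ℕ} (f : (Fin n → ℝ) → ℝ) (t : ℝ) (Q : Cube n) : ℝ :=
  sSup {M : ℝ | volume {y | y ∈ Q.toSet ∧ f y < M} ≤ ENNReal.ofReal t * volume Q.toSet}

/-- The local oscillation `inf_c inf {α ≥ 0 : |{y ∈ Q : |f y - c| > α}| < s |Q|}`. -/
noncomputable def localOsc {n : ℕ} (s : ℝ) (f : (Fin n → ℝ) → ℝ) (Q : Cube n) : ℝ≥0∞ :=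
  ⨅ (c : ℝ) (α : ℝ≥0)
    (_ : volume {y | y ∈ Q.toSet ∧ (α : ℝ) < |f y - c|} < ENNReal.ofReal s * volume Q.toSet),
    (α : ℝ≥0∞)

/-- The local sharp maximal function `M^♯_{0,s,Q₀} f (x)` restricted to `Q₀`: the supremum, in
`[0, ∞]`, of the local oscillations of `f` over all cubes `Q ⊆ Q₀` that contain `x`. -/
noncomputable def sharpMaximal {n : ℕ} (s : ℝ) (Q₀ : Cube n) (f : (Fin n → ℝ) → ℝ)
    (x : Fin n → ℝ) : ℝ≥0∞ :=
  ⨆ (Q : Cube n) (_ : x ∈ Q.toSet) (_ : Q.toSet ⊆ Q₀.toSet), localOsc s f Q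

/-- The union of the dyadic subcubes of `Q₀` named by the words in `F`. -/
def dyadicUnion {n : ℕ} (Q₀ : Cube n) (F : Set (List (Fin n → Bool))) : Set (Fin n → ℝ) :=
  ⋃ w ∈ F, (Q₀.dyadic w).toSet

/-! Stop at the maximal dyadic subcubes whose median differs from that of the starting cube by more
than twice the local oscillation, and repeat inside each of them. On a cube, `f` lies that far from
its median on at most the proportion s (`volume_medianDeviation_le`), whereas such points fill at
least 1 - t of every stopping cube (`le_volume_medianDeviation_inter`). This gives the ratio s / (1
- t).

For the pointwise bound, follow dyadic cubes shrinking to x; their medians tend to f x almost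
everywhere (`ae_tendsto_median`). Telescope over the stopping cubes met on the way. The parent of a
stopping cube has not jumped, so the only new cost is the passage from parent to child. That cost is
linear in n because a chain of intermediate cubes joins the two with total growth 2 ^ n in measure,
and every substantial drift of the centres uses up a doubling (`abs_center_sub_le`). -/

open Filter Topology

/-! ### Geometry of cubes and their dyadic subcubes -/

namespace Cube

variable {n : ℕ}

theorem mem_toSet {Q : Cube n} {x : Fin n → ℝ} :
    x ∈ Q.toSet ↔ ∀ i, Q.corner i ≤ x i ∧ x i ≤ Q.corner i + Q.side := by
  simp only [toSet, mem_Icc, Pi.le_def, forall_and]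

theorem measurableSet_toSet (Q : Cube n) : MeasurableSet Q.toSet := measurableSet_Icc

theorem volume_toSet (Q : Cube n) : volume Q.toSet = ENNReal.ofReal (Q.side ^ n) := by
  rw [toSet, Real.volume_Icc_pi, ENNReal.ofReal_pow Q.side_pos.le]
  simp

theorem volume_toSet_pos (Q : Cube n) : 0 < volume Q.toSet := by
  rw [volume_toSet, ENNReal.ofReal_pos]
  exact pow_pos Q.side_pos n

theorem volume_toSet_ne_top (Q : Cube n) : volume Q.toSet ≠ ∞ := by
  rw [volume_toSet]
  exact ENNReal.ofReal_ne_top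

theorem volume_real_toSet (Q : Cube n) : volume.real Q.toSet = Q.side ^ n := by
  rw [Measure.real, volume_toSet, ENNReal.toReal_ofReal (pow_pos Q.side_pos n).le]

theorem toSet_eq_closedBall (Q : Cube n) :
    Q.toSet = Metric.closedBall (fun i => Q.corner i + Q.side / 2) (Q.side / 2) := by
  rw [closedBall_pi _ (half_pos Q.side_pos).le, toSet, ← pi_univ_Icc]
  congr 1
  ext1 i
  rw [Real.closedBall_eq_Icc]
  congr 1 <;> ring

theorem interior_toSet (Q : Cube n) :
    interior Q.toSet = univ.pi fun i => Ioo (Q.corner i) (Q.corner i + Q.side) := by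
  rw [toSet, ← pi_univ_Icc, interior_pi_set finite_univ]
  simp only [interior_Icc]

theorem interior_toSet_ae_eq (Q : Cube n) :
    (interior Q.toSet : Set (Fin n → ℝ)) =ᵐ[volume] Q.toSet := by
  rw [interior_toSet, toSet]
  exact Measure.univ_pi_Ioo_ae_eq_Icc

theorem aedisjoint_of_disjoint_interior {Q R : Cube n}
    (h : Disjoint (interior Q.toSet) (interior R.toSet)) :
    AEDisjoint volume Q.toSet R.toSet :=
  h.aedisjoint.congr Q.interior_toSet_ae_eq.symm R.interior_toSet_ae_eq.symm

theorem child_subset (Q : Cube n) (ε : Fin n → Bool) : (Q.child ε).toSet ⊆ Q.toSet := by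
  intro x hx
  rw [mem_toSet] at hx ⊢
  intro i
  have h := hx i
  have := Q.side_pos
  simp only [child] at h
  split_ifs at h <;> constructor <;> linarith [h.1, h.2]

theorem exists_mem_child {Q : Cube n} {x : Fin n → ℝ} (hx : x ∈ Q.toSet) :
    ∃ ε, x ∈ (Q.child ε).toSet := by
  refine ⟨fun i => decide (Q.corner i + Q.side / 2 ≤ x i), ?_⟩
  rw [mem_toSet] at hx ⊢
  intro i
  have h := hx i
  by_cases hi : Q.corner i + Q.side / 2 ≤ x i
  · simp only [child, hi, decide_true, if_true, true_and]
    linarith [h.2]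
  · simp only [child, hi, decide_false, Bool.false_eq_true, if_false, add_zero]
    exact ⟨h.1, by linarith [not_le.mp hi]⟩

theorem disjoint_interior_child (Q : Cube n) {ε δ : Fin n → Bool} (h : ε ≠ δ) :
    Disjoint (interior (Q.child ε).toSet) (interior (Q.child δ).toSet) := by
  obtain ⟨i, hi⟩ := Function.ne_iff.mp h
  rw [disjoint_left]
  intro x hx hx'
  rw [interior_toSet, mem_univ_pi] at hx hx'
  have h1 := hx i
  have h2 := hx' i
  simp only [child, mem_Ioo] at h1 h2
  cases hε : ε i <;> cases hδ : δ i <;> simp_all <;> linarith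

theorem dyadic_subset_of_suffix (Q₀ : Cube n) {w w' : List (Fin n → Bool)} (h : w <:+ w') :
    (Q₀.dyadic w').toSet ⊆ (Q₀.dyadic w).toSet := by
  obtain ⟨u, rfl⟩ := h
  induction u with
  | nil => exact subset_rfl
  | cons ε u ih => exact (child_subset _ ε).trans ih

/-- Where the two words first diverge, they pass into different children of a common cube. -/
theorem disjoint_interior_dyadic (Q₀ : Cube n) {w w' : List (Fin n → Bool)}
    (h : ¬ w <:+ w') (h' : ¬ w' <:+ w) :
    Disjoint (interior (Q₀.dyadic w).toSet) (interior (Q₀.dyadic w').toSet) := by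
  induction w with
  | nil => exact absurd (List.nil_suffix) h
  | cons ε a ih =>
    by_cases ha : a <:+ w'
    · obtain ⟨u, rfl⟩ := ha
      rcases List.eq_nil_or_concat u with rfl | ⟨u, δ, rfl⟩
      · exact absurd (List.suffix_cons ε a) h'
      · have hδ : (δ :: a) <:+ (u.concat δ ++ a) := ⟨u, by simp⟩
        have hne : ε ≠ δ := by
          rintro rfl
          exact h hδ
        exact (disjoint_interior_child _ hne).mono_right
          (interior_mono (dyadic_subset_of_suffix Q₀ hδ))
    · exact (ih ha fun h1 => h' (h1.trans (List.suffix_cons ε a))).mono_left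
        (interior_mono (child_subset _ ε))

theorem side_dyadic (Q₀ : Cube n) (w : List (Fin n → Bool)) :
    (Q₀.dyadic w).side = Q₀.side * (1 / 2) ^ w.length := by
  induction w with
  | nil => simp [dyadic]
  | cons ε w ih =>
    simp only [dyadic, child, List.length_cons, pow_succ, ih]
    ring

/-- A choice of nested dyadic subcubes of `Q₀` shrinking to the point `x`. -/
theorem exists_dyadic_chain (Q₀ : Cube n) {x : Fin n → ℝ} (hx : x ∈ Q₀.toSet) :
    ∃ w : ℕ → List (Fin n → Bool), w 0 = [] ∧ (∀ k, (w (k + 1)).tail = w k) ∧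
      (∀ k, (w k).length = k) ∧ ∀ k, x ∈ (Q₀.dyadic (w k)).toSet := by
  have step : ∀ u : {u // x ∈ (Q₀.dyadic u).toSet}, ∃ ε, x ∈ (Q₀.dyadic (ε :: u.1)).toSet :=
    fun u => exists_mem_child u.2
  choose e he using step
  let W : ℕ → {u // x ∈ (Q₀.dyadic u).toSet} := fun k =>
    Nat.rec ⟨[], hx⟩ (fun _ u => ⟨e u :: u.1, he u⟩) k
  refine ⟨fun k => (W k).1, rfl, fun k => rfl, fun k => ?_, fun k => (W k).2⟩
  induction k with
  | zero => rfl
  | succ k ih => exact congrArg (· + 1) ih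

/-- The cubes that interpolate between a dyadic child of `Q` (`θ = 0`) and `Q` (`θ = 1`). -/
noncomputable def interpolate (Q : Cube n) (ε : Fin n → Bool) (θ : ℝ≥0) : Cube n where
  corner := fun i => Q.corner i + (1 - θ) * if ε i then Q.side / 2 else 0
  side := (1 + θ) * (Q.side / 2)
  side_pos := mul_pos (by positivity) (half_pos Q.side_pos)

theorem interpolate_zero (Q : Cube n) (ε : Fin n → Bool) : Q.interpolate ε 0 = Q.child ε := by
  simp [interpolate, child]

theorem interpolate_one (Q : Cube n) (ε : Fin n → Bool) : Q.interpolate ε 1 = Q := by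
  cases Q
  simp only [interpolate, NNReal.coe_one, sub_self, zero_mul, add_zero, mk.injEq, true_and]
  ring

/-- In each coordinate the face shared by the child and `Q` stays fixed, and only the opposite face
moves outwards. -/
theorem interpolate_mono (Q : Cube n) (ε : Fin n → Bool) :
    Monotone fun θ => (Q.interpolate ε θ).toSet := by
  intro a b hab x hx
  have hab' : (a : ℝ) ≤ b := hab
  simp only [mem_toSet, interpolate] at hx ⊢
  intro i
  have h := hx i
  have hm := mul_le_mul_of_nonneg_right hab' (half_pos Q.side_pos).le
  split_ifs at h ⊢ <;> constructor <;> nlinarith [h.1, h.2]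

end Cube

/-! ### Medians and local oscillation -/

section Medians

variable {n : ℕ} {f : (Fin n → ℝ) → ℝ} {s t : ℝ} {Q : Cube n}

theorem volume_sep_mono {p q : (Fin n → ℝ) → Prop} (h : ∀ y ∈ Q.toSet, p y → q y) :
    volume {y | y ∈ Q.toSet ∧ p y} ≤ volume {y | y ∈ Q.toSet ∧ q y} :=
  measure_mono fun y hy => ⟨hy.1, h y hy.1 hy.2⟩

theorem volume_sep_add_volume_sep_not (hf : Measurable f) (p : ℝ → Prop) (hp : MeasurableSet {r | p r}) :
    volume {y | y ∈ Q.toSet ∧ p (f y)} + volume {y | y ∈ Q.toSet ∧ ¬ p (f y)} =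
      volume Q.toSet :=
  measure_inter_add_sdiff Q.toSet (hf hp)

/-- If `f` is within `α` of `c` on most of `Q`, then `c - α` and `c + α` enclose the supremum that
defines the median. -/
theorem sub_mem_and_le_add_of_volume_lt (hf : Measurable f) (hst : s ≤ t) (hts : t < 1 - s)
    (hs : 0 < s) {c α : ℝ}
    (h : volume {y | y ∈ Q.toSet ∧ α < |f y - c|} < ENNReal.ofReal s * volume Q.toSet) :
    c - α ∈ {M : ℝ | volume {y | y ∈ Q.toSet ∧ f y < M} ≤ ENNReal.ofReal t * volume Q.toSet} ∧
    c + α ∈ upperBounds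
      {M : ℝ | volume {y | y ∈ Q.toSet ∧ f y < M} ≤ ENNReal.ofReal t * volume Q.toSet} := by
  constructor
  · refine (volume_sep_mono fun y _ hy => ?_).trans
      (h.le.trans (mul_le_mul_left (ENNReal.ofReal_le_ofReal hst) _))
    rw [abs_sub_comm]
    exact lt_of_lt_of_le (by linarith) (le_abs_self _)
  · intro M hM
    -- Otherwise `f < M` wherever `|f - c| ≤ α`, and `Q` splits into two parts of total proportion
    -- less than s + t < 1.
    by_contra! hlt
    have hadd := volume_sep_add_volume_sep_not (Q := Q) hf (fun r => α < |r - c|)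
      (measurableSet_lt measurable_const (by fun_prop))
    have h2 : volume {y | y ∈ Q.toSet ∧ ¬ α < |f y - c|} ≤ ENNReal.ofReal t * volume Q.toSet := by
      refine (volume_sep_mono fun y _ hy => ?_).trans hM
      have := le_abs_self (f y - c)
      linarith [not_lt.mp hy]
    have h3 : volume Q.toSet < volume Q.toSet := calc
      volume Q.toSet = _ := hadd.symm
      _ < ENNReal.ofReal s * volume Q.toSet + ENNReal.ofReal t * volume Q.toSet :=
        ENNReal.add_lt_add_of_lt_of_le
          (h2.trans_lt (ENNReal.mul_lt_top ENNReal.ofReal_lt_top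
            Q.volume_toSet_ne_top.lt_top)).ne h h2
      _ = ENNReal.ofReal (s + t) * volume Q.toSet := by
        rw [ENNReal.ofReal_add hs.le (hs.le.trans hst), add_mul]
      _ ≤ ENNReal.ofReal 1 * volume Q.toSet :=
        mul_le_mul_left (ENNReal.ofReal_le_ofReal (by linarith)) _
      _ = volume Q.toSet := by simp
    exact lt_irrefl _ h3

/-- Since `f` is finite, its superlevel sets in `Q` decrease to the empty set. This makes the median
a genuine supremum and the oscillation finite. -/
theorem exists_volume_lt (hf : Measurable f) (hs : 0 < s) (Q : Cube n) :
    ∃ α : ℝ≥0, volume {y | y ∈ Q.toSet ∧ (α : ℝ) < |f y - 0|} <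
      ENNReal.ofReal s * volume Q.toSet := by
  have hlim : Tendsto (fun k : ℕ => volume {y | y ∈ Q.toSet ∧ (k : ℝ) < |f y - 0|}) atTop
      (𝓝 (volume (⋂ k : ℕ, {y | y ∈ Q.toSet ∧ (k : ℝ) < |f y - 0|}))) := by
    refine tendsto_measure_iInter_atTop (fun k => ?_) (fun a b hab y hy => ⟨hy.1, ?_⟩) ⟨0, ?_⟩
    · exact (Q.measurableSet_toSet.inter
        (measurableSet_lt measurable_const (hf.sub_const 0).abs)).nullMeasurableSet
    · exact (Nat.cast_le.mpr hab).trans_lt hy.2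
    · exact ((measure_mono fun y hy => hy.1).trans_lt Q.volume_toSet_ne_top.lt_top).ne
  have hempty : (⋂ k : ℕ, {y | y ∈ Q.toSet ∧ (k : ℝ) < |f y - 0|}) = ∅ := by
    rw [eq_empty_iff_forall_notMem]
    intro y hy
    obtain ⟨k, hk⟩ := exists_nat_ge |f y - 0|
    exact absurd (mem_iInter.mp hy k).2 (not_lt.mpr hk)
  rw [hempty, measure_empty] at hlim
  obtain ⟨k, hk⟩ := (hlim.eventually_lt_const
    (ENNReal.mul_pos (ENNReal.ofReal_pos.mpr hs).ne' Q.volume_toSet_pos.ne')).exists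
  exact ⟨k, by simpa using hk⟩

theorem median_set_nonempty (hf : Measurable f) (hst : s ≤ t) (hts : t < 1 - s) (hs : 0 < s)
    (Q : Cube n) : {M : ℝ | volume {y | y ∈ Q.toSet ∧ f y < M} ≤
      ENNReal.ofReal t * volume Q.toSet}.Nonempty :=
  have ⟨_, h⟩ := exists_volume_lt hf hs Q
  ⟨_, (sub_mem_and_le_add_of_volume_lt hf hst hts hs h).1⟩

theorem median_set_bddAbove (hf : Measurable f) (hst : s ≤ t) (hts : t < 1 - s) (hs : 0 < s)
    (Q : Cube n) : BddAbove {M : ℝ | volume {y | y ∈ Q.toSet ∧ f y < M} ≤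
      ENNReal.ofReal t * volume Q.toSet} :=
  have ⟨_, h⟩ := exists_volume_lt hf hs Q
  ⟨_, (sub_mem_and_le_add_of_volume_lt hf hst hts hs h).2⟩

theorem abs_median_sub_le (hf : Measurable f) (hst : s ≤ t) (hts : t < 1 - s) (hs : 0 < s)
    {c α : ℝ}
    (h : volume {y | y ∈ Q.toSet ∧ α < |f y - c|} < ENNReal.ofReal s * volume Q.toSet) :
    |median f t Q - c| ≤ α := by
  obtain ⟨h1, h2⟩ := sub_mem_and_le_add_of_volume_lt hf hst hts hs h
  have h3 := le_csSup ⟨_, h2⟩ h1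
  have h4 := csSup_le ⟨_, h1⟩ h2
  rw [abs_le]
  constructor <;> unfold median <;> linarith

theorem exists_center_of_localOsc_lt {K : ℝ≥0} (h : localOsc s f Q < K) :
    ∃ c : ℝ, volume {y | y ∈ Q.toSet ∧ (K : ℝ) < |f y - c|} <
      ENNReal.ofReal s * volume Q.toSet := by
  simp only [localOsc, iInf_lt_iff] at h
  obtain ⟨c, α, hc, hα⟩ := h
  refine ⟨c, (volume_sep_mono fun y _ hy => ?_).trans_lt hc⟩
  exact lt_of_le_of_lt (NNReal.coe_le_coe.mpr (ENNReal.coe_lt_coe.mp hα).le) hy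

theorem localOsc_lt_top (hf : Measurable f) (hs : 0 < s) (Q : Cube n) : localOsc s f Q < ∞ := by
  obtain ⟨α, h⟩ := exists_volume_lt hf hs Q
  refine lt_of_le_of_lt ?_ (ENNReal.coe_lt_top (r := α))
  exact (iInf_le _ (0 : ℝ)).trans ((iInf_le _ α).trans (iInf_le _ h))

theorem localOsc_le_sharpMaximal {Q₀ : Cube n} (h : Q.toSet ⊆ Q₀.toSet) {x : Fin n → ℝ}
    (hx : x ∈ Q.toSet) : localOsc s f Q ≤ sharpMaximal s Q₀ f x :=
  le_iSup_of_le Q (le_iSup_of_le hx (le_iSup_of_le h le_rfl))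

/-- The part of `Q` on which `f` is far from its median. -/
def medianDeviation (s t : ℝ) (f : (Fin n → ℝ) → ℝ) (Q : Cube n) : Set (Fin n → ℝ) :=
  {y | y ∈ Q.toSet ∧ 2 * localOsc s f Q < ENNReal.ofReal |f y - median f t Q|}

theorem measurableSet_medianDeviation (hf : Measurable f) :
    MeasurableSet (medianDeviation s t f Q) :=
  Q.measurableSet_toSet.inter (measurableSet_lt measurable_const (hf.sub_const _).abs.ennreal_ofReal)

/-- For K above the oscillation, some centre c is within K of both the median and most values of
`f`, so deviation beyond 2K has proportion below s. The oscillation need not be attained, so K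
decreases to it and continuity from below is used. -/
theorem volume_medianDeviation_le (hf : Measurable f) (hst : s ≤ t) (hts : t < 1 - s)
    (hs : 0 < s) :
    volume (medianDeviation s t f Q) ≤ ENNReal.ofReal s * volume Q.toSet := by
  obtain ⟨ω, hω⟩ : ∃ ω : ℝ≥0, (ω : ℝ≥0∞) = localOsc s f Q :=
    ⟨_, ENNReal.coe_toNNReal (localOsc_lt_top hf hs Q).ne⟩
  let u : ℕ → ℝ≥0 := fun k => ω + 1 / (k + 1)
  have hu : Tendsto u atTop (𝓝 ω) := by
    have h1 : Tendsto (fun k : ℕ => 1 / ((k : ℝ≥0) + 1)) atTop (𝓝 0) :=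
      tendsto_one_div_add_atTop_nhds_zero_nat
    simpa [u] using (tendsto_const_nhds (x := ω)).add h1
  have hanti : Antitone u := by
    intro a b hab
    exact add_le_add le_rfl (one_div_le_one_div_of_le (by positivity)
      (add_le_add (Nat.cast_le.mpr hab) le_rfl))
  let E : ℕ → Set (Fin n → ℝ) := fun k =>
    {y | y ∈ Q.toSet ∧ 2 * (u k : ℝ) < |f y - median f t Q|}
  have hE : Monotone E := by
    intro a b hab y hy
    refine ⟨hy.1, lt_of_le_of_lt ?_ hy.2⟩
    have : (u b : ℝ) ≤ u a := hanti hab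
    linarith
  have hsub : medianDeviation s t f Q ⊆ ⋃ k, E k := by
    intro y hy
    have h2 : 2 * (ω : ℝ) < |f y - median f t Q| := by
      have h := hy.2
      rw [← hω, ← ENNReal.ofReal_coe_nnreal, ← ENNReal.ofReal_ofNat,
        ← ENNReal.ofReal_mul (by norm_num)] at h
      exact (ENNReal.ofReal_lt_ofReal_iff_of_nonneg (by positivity)).mp h
    have h3 : Tendsto (fun k => 2 * (u k : ℝ)) atTop (𝓝 (2 * (ω : ℝ))) :=
      (NNReal.tendsto_coe.mpr hu).const_mul 2
    obtain ⟨k, hk⟩ := (h3.eventually_lt_const h2).exists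
    exact mem_iUnion.mpr ⟨k, hy.1, hk⟩
  refine (measure_mono hsub).trans ?_
  rw [hE.measure_iUnion]
  refine iSup_le fun k => ?_
  have hlt : localOsc s f Q < u k := by
    rw [← hω, ENNReal.coe_lt_coe]
    exact lt_add_of_pos_right _ (by positivity)
  obtain ⟨c, hc⟩ := exists_center_of_localOsc_lt hlt
  have hm := abs_median_sub_le hf hst hts hs hc
  refine (volume_sep_mono fun y _ hy => ?_).trans hc.le
  have h4 := abs_sub_le (f y) c (median f t Q)
  rw [abs_sub_comm c] at h4
  linarith

/-- If the median over `R` is too high, then `f` is high on at least 1 - t of `R`. If it is too low,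
then `f` is low on more than t of `R`, which is enough because t ≥ 1 / 2. -/
theorem le_volume_medianDeviation_inter (hf : Measurable f) (hst : s ≤ t) (hts : t < 1 - s)
    (hs : 0 < s) (ht : 1 / 2 ≤ t) {R : Cube n} (hR : R.toSet ⊆ Q.toSet)
    (h : 2 * localOsc s f Q < ENNReal.ofReal |median f t R - median f t Q|) :
    ENNReal.ofReal (1 - t) * volume R.toSet ≤
      volume (medianDeviation s t f Q ∩ R.toSet) := by
  obtain ⟨ω, hω⟩ : ∃ ω : ℝ≥0, (ω : ℝ≥0∞) = localOsc s f Q :=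
    ⟨_, ENNReal.coe_toNNReal (localOsc_lt_top hf hs Q).ne⟩
  have key : ∀ r : ℝ, 2 * localOsc s f Q < ENNReal.ofReal |r| ↔ 2 * (ω : ℝ) < |r| := by
    intro r
    rw [← hω, ← ENNReal.ofReal_coe_nnreal, ← ENNReal.ofReal_ofNat,
      ← ENNReal.ofReal_mul (by norm_num),
      ENNReal.ofReal_lt_ofReal_iff_of_nonneg (by positivity)]
  rw [key, lt_abs] at h
  rcases h with h | h
  · obtain ⟨M, hM, hlt⟩ := exists_lt_of_lt_csSup (median_set_nonempty hf hst hts hs R)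
      (show median f t Q + 2 * ω < median f t R by linarith)
    have hadd := volume_sep_add_volume_sep_not (Q := R) hf (fun r => r < M) measurableSet_Iio
    have hsub : volume {y | y ∈ R.toSet ∧ ¬ f y < M} ≤
        volume (medianDeviation s t f Q ∩ R.toSet) := by
      refine measure_mono fun y hy => ⟨⟨hR hy.1, ?_⟩, hy.1⟩
      rw [key]
      exact lt_of_lt_of_le (by linarith [not_lt.mp hy.2]) (le_abs_self _)
    have h1 : ENNReal.ofReal t * volume R.toSet + ENNReal.ofReal (1 - t) * volume R.toSet =
        volume R.toSet := by
      rw [← add_mul, ← ENNReal.ofReal_add (by linarith) (by linarith)]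
      simp
    refine (ENNReal.add_le_add_iff_left (a := ENNReal.ofReal t * volume R.toSet)
      (ENNReal.mul_lt_top ENNReal.ofReal_lt_top R.volume_toSet_ne_top.lt_top).ne).mp ?_
    rw [h1]
    exact hadd.symm.le.trans (add_le_add hM hsub)
  · obtain ⟨M, hlt, hM⟩ := exists_between
      (show median f t R < median f t Q - 2 * ω by linarith)
    have hM' := notMem_of_csSup_lt hlt (median_set_bddAbove hf hst hts hs R)
    rw [mem_ofPred_eq, not_le] at hM'
    refine (mul_le_mul_left (ENNReal.ofReal_le_ofReal (by linarith)) _).trans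
      (hM'.le.trans (measure_mono fun y hy => ⟨⟨hR hy.1, ?_⟩, hy.1⟩))
    rw [key, abs_sub_comm]
    exact lt_of_lt_of_le (by linarith [hy.2]) (le_abs_self _)

theorem median_le_of_lt_volume (hf : Measurable f) (hst : s ≤ t) (hts : t < 1 - s) (hs : 0 < s)
    {q : ℝ} (h : ENNReal.ofReal t * volume Q.toSet < volume {y | y ∈ Q.toSet ∧ f y < q}) :
    median f t Q ≤ q := by
  refine csSup_le (median_set_nonempty hf hst hts hs Q) fun M hM => ?_
  by_contra! hlt
  exact absurd ((volume_sep_mono fun y _ hy => hy.trans hlt).trans hM) (not_le.mpr h)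

theorem le_median_of_lt_volume (hf : Measurable f) (hst : s ≤ t) (hts : t < 1 - s) (hs : 0 < s)
    {p : ℝ} (h : ENNReal.ofReal (1 - t) * volume Q.toSet < volume {y | y ∈ Q.toSet ∧ p < f y}) :
    p ≤ median f t Q := by
  refine le_csSup (median_set_bddAbove hf hst hts hs Q) ?_
  by_contra! hlt
  rw [mem_ofPred_eq, not_le] at hlt
  have hadd := volume_sep_add_volume_sep_not (Q := Q) hf (fun r => p < r) measurableSet_Ioi
  have h1 : volume {y | y ∈ Q.toSet ∧ f y < p} ≤ volume {y | y ∈ Q.toSet ∧ ¬ p < f y} :=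
    measure_mono fun y hy => ⟨hy.1, hy.2.not_gt⟩
  have h2 := ENNReal.add_lt_add h (hlt.trans_le h1)
  rw [hadd, ← add_mul, ← ENNReal.ofReal_add (by linarith) (by linarith)] at h2
  simp at h2

/-- The medians over dyadic cubes shrinking to almost every point converge to the function. -/
theorem ae_tendsto_median (hf : Measurable f) (hst : s ≤ t) (hts : t < 1 - s) (hs : 0 < s) :
    ∀ᵐ x, ∀ (Q₀ : Cube n) (w : ℕ → List (Fin n → Bool)), (∀ k, (w k).length = k) →
      (∀ k, x ∈ (Q₀.dyadic (w k)).toSet) →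
      Tendsto (fun k => median f t (Q₀.dyadic (w k))) atTop (𝓝 (f x)) := by
  have hdens : ∀ S : Set (Fin n → ℝ), MeasurableSet S → ∀ᵐ x, x ∈ S →
      ∀ (Q₀ : Cube n) (w : ℕ → List (Fin n → Bool)), (∀ k, (w k).length = k) →
      (∀ k, x ∈ (Q₀.dyadic (w k)).toSet) → ∀ r : ℝ, r < 1 →
      ∀ᶠ k in atTop, ENNReal.ofReal r * volume (Q₀.dyadic (w k)).toSet <
        volume ((Q₀.dyadic (w k)).toSet ∩ S) := by
    intro S hS
    -- Cubes are sup-norm balls that contain x without being centred there; this form of the density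
    -- theorem, with constant 1, allows that.
    have h := IsUnifLocDoublingMeasure.ae_tendsto_measure_inter_div
      (volume : Measure (Fin n → ℝ)) S 1
    rw [ae_restrict_iff' hS] at h
    filter_upwards [h] with x hx hxS Q₀ w hw hxw r hr
    have hside : ∀ k, (Q₀.dyadic (w k)).side = Q₀.side * (1 / 2) ^ k := fun k => by
      rw [Cube.side_dyadic, hw]
    have hlim : Tendsto (fun k => (Q₀.dyadic (w k)).side / 2) atTop (𝓝[>] 0) := by
      refine tendsto_nhdsWithin_iff.mpr
        ⟨?_, Eventually.of_forall fun k => half_pos (Q₀.dyadic (w k)).side_pos⟩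
      simp only [hside]
      have := ((tendsto_pow_atTop_nhds_zero_of_lt_one (r := (1 / 2 : ℝ))
        (by norm_num) (by norm_num)).const_mul Q₀.side).div_const 2
      simpa using this
    have h1 := hx hxS (fun k i => (Q₀.dyadic (w k)).corner i + (Q₀.dyadic (w k)).side / 2)
      (fun k => (Q₀.dyadic (w k)).side / 2) hlim
      (Eventually.of_forall fun k => by
        rw [one_mul, ← Cube.toSet_eq_closedBall]
        exact hxw k)
    simp only [← Cube.toSet_eq_closedBall] at h1
    have hr' : ENNReal.ofReal r < 1 := by simpa using hr
    filter_upwards [h1.eventually_const_lt hr'] with k hk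
    rw [inter_comm]
    exact (ENNReal.lt_div_iff_mul_lt (Or.inl (Cube.volume_toSet_pos _).ne')
      (Or.inl (Cube.volume_toSet_ne_top _))).mp hk
  -- Rational levels keep the exceptional null sets countable in number.
  have h1 : ∀ᵐ x, ∀ q : ℚ, _ := ae_all_iff.mpr fun q : ℚ =>
    hdens {y | f y < q} (measurableSet_lt hf measurable_const)
  have h2 : ∀ᵐ x, ∀ q : ℚ, _ := ae_all_iff.mpr fun q : ℚ =>
    hdens {y | q < f y} (measurableSet_lt measurable_const hf)
  filter_upwards [h1, h2] with x hx1 hx2 Q₀ w hw hxw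
  rw [tendsto_order]
  constructor
  · intro a ha
    obtain ⟨p, hap, hp⟩ := exists_rat_btwn ha
    filter_upwards [hx2 p hp Q₀ w hw hxw (1 - t) (by linarith)] with k hk
    exact hap.trans_le (le_median_of_lt_volume hf hst hts hs hk)
  · intro b hb
    obtain ⟨q, hq, hqb⟩ := exists_rat_btwn hb
    filter_upwards [hx1 q hq Q₀ w hw hxw t (by linarith)] with k hk
    exact (median_le_of_lt_volume hf hst hts hs hk).trans_lt hqb

end Medians

/-! ### Comparing the medians of a dyadic child and its parent -/

/-- Along an increasing sequence of sets of slowly growing measure, suppose that on more than half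
of each set `P i` the function `f` is within `K` of `c i`. Then the total change of `c` is controlled
by `K` and the number of times that the measure doubles. -/
theorem abs_center_sub_le {X : Type*} [MeasurableSpace X] (μ : Measure X) {f : X → ℝ}
    (hf : Measurable f) {K s : ℝ} (hK : 0 ≤ K) (hs : s < 1 / 2) {N : ℕ} {P : ℕ → Set X}
    (hPm : ∀ i, MeasurableSet (P i)) (hPfin : ∀ i, μ (P i) ≠ ∞) (hP : Monotone P)
    (hpos : 0 < μ.real (P 0)) {c : ℕ → ℝ}
    (hc : ∀ i ≤ N, (1 - s) * μ.real (P i) < μ.real (P i ∩ f ⁻¹' Metric.closedBall (c i) K))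
    (hratio : ∀ i < N, s * μ.real (P (i + 1)) < (1 - s) * μ.real (P i))
    {n : ℕ} (hn : μ.real (P N) ≤ 2 ^ n * μ.real (P 0)) :
    |c 0 - c N| ≤ (4 * n + 2) * K := by
  have hmono : ∀ {i j : ℕ} (A : Set X), i ≤ j → μ.real (P i ∩ A) ≤ μ.real (P j ∩ A) :=
    fun {i j} A hij => measureReal_mono (inter_subset_inter_left _ (hP hij))
      ((measure_mono inter_subset_left).trans_lt (hPfin j).lt_top).ne
  have hle : ∀ (i : ℕ) (A : Set X), μ.real (P i ∩ A) ≤ μ.real (P i) :=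
    fun i A => measureReal_mono inter_subset_left (hPfin i)
  have hPpos : ∀ i, 0 < μ.real (P i) := fun i =>
    hpos.trans_le (measureReal_mono (hP (Nat.zero_le i)) (hPfin i))
  have hunion : ∀ (i : ℕ) {U V : Set ℝ}, MeasurableSet V → Disjoint U V →
      μ.real (P i ∩ f ⁻¹' (U ∪ V)) = μ.real (P i ∩ f ⁻¹' U) + μ.real (P i ∩ f ⁻¹' V) := by
    intro i U V hV hUV
    rw [preimage_union, inter_union_distrib_left]
    exact measureReal_union
      (((hUV.preimage f).mono inter_subset_right inter_subset_right))
      ((hPm i).inter (hf hV))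
      ((measure_mono inter_subset_left).trans_lt (hPfin i).lt_top).ne
      ((measure_mono inter_subset_left).trans_lt (hPfin i).lt_top).ne
  have hfar : ∀ {i j : ℕ}, ¬ |c i - c j| ≤ 2 * K →
      Disjoint (Metric.closedBall (c i) K) (Metric.closedBall (c j) K) := by
    intro i j hij
    refine Metric.closedBall_disjoint_closedBall ?_
    rw [Real.dist_eq]
    linarith
  -- Disjoint balls would put more than (1 - s)(μ(P i) + μ(P (i + 1))) into `P (i + 1)`, against
  -- `hratio`.
  have hsucc : ∀ i < N, |c i - c (i + 1)| ≤ 2 * K := by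
    intro i hi
    by_contra h
    have h1 := hunion (i + 1) Metric.isClosed_closedBall.measurableSet (hfar h)
    have h2 := hle (i + 1) (f ⁻¹' (Metric.closedBall (c i) K ∪ Metric.closedBall (c (i + 1)) K))
    have h3 := hmono (f ⁻¹' Metric.closedBall (c i) K) (Nat.le_succ i)
    linarith [hc i hi.le, hc (i + 1) hi, hratio i hi]
  by_contra hcon
  -- `W` collects values that no later ball meets. Each round moves the centre by at most 4K and
  -- doubles the lower bound on the mass; n + 1 rounds exceed the mass available.
  have inv : ∀ k ≤ n + 1, ∃ i ≤ N, ∃ W : Set ℝ, |c 0 - c i| ≤ 4 * k * K ∧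
      (∀ j, i ≤ j → j ≤ N → Disjoint W (Metric.closedBall (c j) K)) ∧
      2 ^ k * μ.real (P 0) < 2 * μ.real (P i ∩ f ⁻¹' (W ∪ Metric.closedBall (c i) K)) := by
    intro k
    induction k with
    | zero =>
      intro _
      refine ⟨0, Nat.zero_le _, ∅, by simp, fun _ _ _ => empty_disjoint _, ?_⟩
      rw [empty_union]
      nlinarith [hc 0 (Nat.zero_le _)]
    | succ k ih =>
      intro hk
      obtain ⟨i, hi, W, hci, hW, hmass⟩ := ih (by omega)
      have hkn : (k : ℝ) ≤ n := by exact_mod_cast Nat.le_of_succ_le_succ hk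
      have hiN : ¬ |c i - c N| ≤ 2 * K := by
        intro h
        have h1 := abs_sub_le (c 0) (c i) (c N)
        exact hcon (by nlinarith)
      -- After the last index whose centre is within 2K of `c i`, every ball misses that of `c i`,
      -- which can then join `W`. By `hiN`, index `l + 1` still lies in the chain.
      let l := Nat.findGreatest (fun j => i ≤ j ∧ |c i - c j| ≤ 2 * K) N
      have hl : i ≤ l ∧ |c i - c l| ≤ 2 * K :=
        Nat.findGreatest_spec (P := fun j => i ≤ j ∧ |c i - c j| ≤ 2 * K) hi
          ⟨le_rfl, by simpa using hK⟩
      have hlN : l < N := lt_of_le_of_ne (Nat.findGreatest_le N) fun h => hiN (h ▸ hl.2)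
      have hgt : ∀ j, l < j → j ≤ N → ¬ |c i - c j| ≤ 2 * K := fun j hj hjN h =>
        Nat.findGreatest_is_greatest hj hjN ⟨hl.1.trans hj.le, h⟩
      have hdisj : ∀ j, l + 1 ≤ j → j ≤ N →
          Disjoint (W ∪ Metric.closedBall (c i) K) (Metric.closedBall (c j) K) := fun j hj hjN =>
        disjoint_union_left.mpr ⟨hW j (by omega) hjN, hfar (hgt j hj hjN)⟩
      refine ⟨l + 1, hlN, W ∪ Metric.closedBall (c i) K, ?_, hdisj, ?_⟩
      · have h1 := abs_sub_le (c 0) (c i) (c (l + 1))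
        have h2 := abs_sub_le (c i) (c l) (c (l + 1))
        push_cast
        linarith [hsucc l hlN, hl.2]
      -- The new ball takes more than half of `P (l + 1)`, so it outweighs the old mass, from which
      -- it is disjoint.
      · have h1 := hunion (l + 1) Metric.isClosed_closedBall.measurableSet
          (hdisj (l + 1) le_rfl hlN)
        have h2 := hle (l + 1) (f ⁻¹' (W ∪ Metric.closedBall (c i) K ∪
          Metric.closedBall (c (l + 1)) K))
        have h3 := hmono (f ⁻¹' (W ∪ Metric.closedBall (c i) K)) (hl.1.trans (Nat.le_succ l))
        have h4 := hc (l + 1) hlN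
        have h5 := hPpos (l + 1)
        have h6 : s * μ.real (P (l + 1)) < 1 / 2 * μ.real (P (l + 1)) :=
          mul_lt_mul_of_pos_right hs h5
        rw [pow_succ]
        linarith
  obtain ⟨i, hi, W, -, -, hmass⟩ := inv (n + 1) le_rfl
  have h1 := hle i (f ⁻¹' (W ∪ Metric.closedBall (c i) K))
  have h2 := measureReal_mono (μ := μ) (hP hi) (hPfin N)
  rw [pow_succ] at hmass
  linarith

section Parent

variable {n : ℕ} {f : (Fin n → ℝ) → ℝ} {s t : ℝ}

/-- The child is too small a part of `Q` for a direct comparison. All interpolating cubes contain y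
and lie in `Q`, so their oscillations are below K. The chain costs (4n + 2)K and the two end medians
K each; 4n + 4 ≤ 10n since n ≥ 1. -/
theorem abs_median_child_sub_le (hn : 1 ≤ n) (hf : Measurable f) (hs : 0 < s) (hs2 : s < 1 / 2)
    (hst : s ≤ t) (hts : t < 1 - s) (Q : Cube n) (ε : Fin n → Bool) {K : ℝ≥0} {y : Fin n → ℝ}
    (hy : y ∈ (Q.child ε).toSet) (hK : sharpMaximal s Q f y < K) :
    |median f t (Q.child ε) - median f t Q| ≤ 10 * n * K := by
  -- One step multiplies the side by at most 1 + 1 / N; since s < 1 / 2, a large N makes the growth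
  -- of measure slow enough.
  obtain ⟨N, hN0, hN⟩ : ∃ N : ℕ, 0 < N ∧ s * (1 + 1 / (N : ℝ)) ^ n < 1 - s := by
    have h0 : Tendsto (fun N : ℕ => s * (1 + 1 / (N : ℝ)) ^ n) atTop (𝓝 s) := by
      have := ((tendsto_one_div_atTop_nhds_zero_nat (𝕜 := ℝ)).const_add 1).pow n |>.const_mul s
      simpa using this
    have := (h0.eventually_lt_const (show s < 1 - s by linarith)).and (eventually_gt_atTop 0)
    obtain ⟨N, h1, h2⟩ := this.exists
    exact ⟨N, h2, h1⟩
  let θ : ℕ → ℝ≥0 := fun i => i / N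
  let P : ℕ → Cube n := fun i => Q.interpolate ε (θ i)
  have hθ : Monotone θ := fun a b hab => by
    simp only [θ]
    gcongr
  have hP : Monotone fun i => (P i).toSet := (Q.interpolate_mono ε).comp hθ
  have hP0 : P 0 = Q.child ε := by simp [P, θ, Cube.interpolate_zero]
  have hPN : P N = Q := by
    have : θ N = 1 := div_self (by exact_mod_cast hN0.ne')
    simp [P, this, Cube.interpolate_one]
  have hcen : ∀ i, ∃ c : ℝ, i ≤ N → volume {z | z ∈ (P i).toSet ∧ (K : ℝ) < |f z - c|} <
      ENNReal.ofReal s * volume (P i).toSet := by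
    intro i
    by_cases hi : i ≤ N
    · have h1 : (P i).toSet ⊆ Q.toSet := by
        have := hP hi
        simpa only [hPN] using this
      have h2 : y ∈ (P i).toSet := hP (Nat.zero_le i) (by simpa only [hP0] using hy)
      obtain ⟨c, hc⟩ := exists_center_of_localOsc_lt
        ((localOsc_le_sharpMaximal (s := s) (f := f) h1 h2).trans_lt hK)
      exact ⟨c, fun _ => hc⟩
    · exact ⟨0, fun h => absurd h hi⟩
  choose c hc using hcen
  have hm0 := abs_median_sub_le hf hst hts hs (hc 0 (Nat.zero_le N))
  have hmN := abs_median_sub_le hf hst hts hs (hc N le_rfl)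
  rw [hP0] at hm0
  rw [hPN] at hmN
  have hchain : |c 0 - c N| ≤ (4 * n + 2) * (K : ℝ) := by
    refine abs_center_sub_le volume hf K.coe_nonneg hs2 (P := fun i => (P i).toSet)
      (fun i => (P i).measurableSet_toSet) (fun i => (P i).volume_toSet_ne_top) hP ?_ ?_ ?_ ?_
    · rw [Cube.volume_real_toSet]
      exact pow_pos (P 0).side_pos n
    · intro i hi
      have hset : (P i).toSet ∩ f ⁻¹' Metric.closedBall (c i) K =
          {z | z ∈ (P i).toSet ∧ ¬ (K : ℝ) < |f z - c i|} := by
        ext z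
        simp [Real.dist_eq]
      have h1 := congrArg ENNReal.toReal (volume_sep_add_volume_sep_not (Q := P i) hf
        (fun r => (K : ℝ) < |r - c i|) (measurableSet_lt measurable_const (by fun_prop)))
      have hfin : ∀ p : (Fin n → ℝ) → Prop, volume {z | z ∈ (P i).toSet ∧ p z} ≠ ∞ := fun p =>
        ((measure_mono fun z hz => hz.1).trans_lt (P i).volume_toSet_ne_top.lt_top).ne
      rw [ENNReal.toReal_add (hfin _) (hfin _)] at h1
      have h2 := (ENNReal.toReal_lt_toReal (hfin _) (ENNReal.mul_lt_top ENNReal.ofReal_lt_top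
        (P i).volume_toSet_ne_top.lt_top).ne).mpr (hc i hi)
      rw [ENNReal.toReal_mul, ENNReal.toReal_ofReal hs.le] at h2
      rw [hset]
      simp only [Measure.real]
      linarith
    · intro i _
      simp only [Cube.volume_real_toSet]
      have hNpos : (0 : ℝ) < N := by exact_mod_cast hN0
      have hside : (P (i + 1)).side ≤ (1 + 1 / (N : ℝ)) * (P i).side := by
        simp only [P, θ, Cube.interpolate, NNReal.coe_div, NNReal.coe_natCast]
        rw [← mul_assoc]
        refine mul_le_mul_of_nonneg_right ?_ (half_pos Q.side_pos).le
        have : (0 : ℝ) ≤ i / N * (1 / N) := by positivity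
        push_cast
        rw [add_div]
        nlinarith
      have h1 := pow_le_pow_left₀ (P (i + 1)).side_pos.le hside n
      rw [mul_pow] at h1
      have h2 := mul_le_mul_of_nonneg_left h1 hs.le
      have h3 := mul_lt_mul_of_pos_right hN (pow_pos (P i).side_pos n)
      linarith
    · simp only [Cube.volume_real_toSet, hP0, hPN, Cube.child]
      rw [← mul_pow]
      apply le_of_eq
      congr 1
      ring
  have hn' : (1 : ℝ) ≤ n := by exact_mod_cast hn
  have hK0 : (0 : ℝ) ≤ K := K.coe_nonneg
  have h1 := abs_sub_le (median f t (Q.child ε)) (c 0) (median f t Q)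
  have h2 := abs_sub_le (c 0) (c N) (median f t Q)
  rw [abs_sub_comm (c N)] at h2
  nlinarith [mul_le_mul_of_nonneg_right hn' hK0]

theorem ofReal_abs_median_child_sub_le (hn : 1 ≤ n) (hf : Measurable f) (hs : 0 < s)
    (hs2 : s < 1 / 2) (hst : s ≤ t) (hts : t < 1 - s) (Q : Cube n) (ε : Fin n → Bool) :
    ENNReal.ofReal |median f t (Q.child ε) - median f t Q| ≤
      10 * (n : ℝ≥0∞) * ⨅ y ∈ (Q.child ε).toSet, sharpMaximal s Q f y := by
  have hn0 : (10 * (n : ℝ≥0∞)) ≠ 0 := by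
    simp only [ne_eq, mul_eq_zero, not_or]
    exact ⟨by norm_num, by exact_mod_cast (by omega : n ≠ 0)⟩
  have hntop : (10 * (n : ℝ≥0∞)) ≠ ∞ :=
    ENNReal.mul_ne_top (by norm_num) (ENNReal.natCast_ne_top n)
  rw [mul_comm, ← ENNReal.div_le_iff hn0 hntop]
  refine le_iInf₂ fun y hy => le_of_forall_gt fun b hb => ?_
  obtain ⟨K, hK, hKb⟩ := ENNReal.lt_iff_exists_nnreal_btwn.mp hb
  refine lt_of_le_of_lt ?_ hKb
  rw [ENNReal.div_le_iff hn0 hntop]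
  have h := ENNReal.ofReal_le_ofReal
    (abs_median_child_sub_le hn hf hs hs2 hst hts Q ε hy hK)
  refine h.trans (le_of_eq ?_)
  rw [mul_comm, ENNReal.ofReal_mul K.coe_nonneg, ENNReal.ofReal_mul (by norm_num)]
  simp

end Parent

/-! ### Stopping cubes and the pointwise bound -/

section Decomposition

variable {n : ℕ} {f : (Fin n → ℝ) → ℝ} {s t : ℝ} {Q₀ : Cube n}

/-- The median over the subcube named by `w'` is far from the one over the subcube named by `w`. -/
def MedianJump (s t : ℝ) (f : (Fin n → ℝ) → ℝ) (Q₀ : Cube n) (w w' : List (Fin n → Bool)) : Prop :=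
  2 * localOsc s f (Q₀.dyadic w) <
    ENNReal.ofReal |median f t (Q₀.dyadic w') - median f t (Q₀.dyadic w)|

/-- The maximal dyadic subcubes of the cube named by `w` over which the median jumps. -/
def stoppingWords (s t : ℝ) (f : (Fin n → ℝ) → ℝ) (Q₀ : Cube n) (w : List (Fin n → Bool)) :
    Set (List (Fin n → Bool)) :=
  {w' | w <:+ w' ∧ MedianJump s t f Q₀ w w' ∧
    ∀ u, w <:+ u → u <:+ w' → u ≠ w' → ¬ MedianJump s t f Q₀ w u}

/-- The generations of stopping cubes, the first one being that of the maximal subcubes of `Q₀`. -/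
def generation (s t : ℝ) (f : (Fin n → ℝ) → ℝ) (Q₀ : Cube n) : ℕ → Set (List (Fin n → Bool))
  | 0 => stoppingWords s t f Q₀ []
  | v + 1 => ⋃ w ∈ generation s t f Q₀ v, stoppingWords s t f Q₀ w

/-- The contribution of a stopping cube to the pointwise bound. -/
noncomputable def stoppingTerm (s : ℝ) (f : (Fin n → ℝ) → ℝ) (Q₀ : Cube n)
    (w : List (Fin n → Bool)) : ℝ≥0∞ :=
  10 * (n : ℝ≥0∞) * (⨅ y ∈ (Q₀.dyadic w).toSet, sharpMaximal s (Q₀.dyadic w.tail) f y) +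
    2 * (⨅ y ∈ (Q₀.dyadic w).toSet, sharpMaximal s (Q₀.dyadic w) f y)

theorem ne_of_mem_stoppingWords {w w' : List (Fin n → Bool)}
    (h : w' ∈ stoppingWords s t f Q₀ w) : w ≠ w' := by
  rintro rfl
  simpa [MedianJump] using h.2.1

theorem exists_cons_of_mem_stoppingWords {w w' : List (Fin n → Bool)}
    (h : w' ∈ stoppingWords s t f Q₀ w) : ∃ ε a, w' = ε :: a ∧ w <:+ a := by
  cases w' with
  | nil => exact absurd (List.suffix_nil.mp h.1) (ne_of_mem_stoppingWords h)
  | cons ε a =>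
    exact ⟨ε, a, rfl, (List.suffix_cons_iff.mp h.1).resolve_left (ne_of_mem_stoppingWords h)⟩

theorem eq_of_suffix_of_mem_stoppingWords {w a b : List (Fin n → Bool)}
    (ha : a ∈ stoppingWords s t f Q₀ w) (hb : b ∈ stoppingWords s t f Q₀ w) (h : a <:+ b) :
    a = b := by
  by_contra hne
  exact hb.2.2 a ha.1 h hne ha.2.1

theorem ne_nil_of_mem_generation {v : ℕ} {w : List (Fin n → Bool)}
    (h : w ∈ generation s t f Q₀ v) : w ≠ [] := by
  have : ∃ u, w ∈ stoppingWords s t f Q₀ u := by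
    cases v with
    | zero => exact ⟨_, h⟩
    | succ v =>
      obtain ⟨u, -, hu⟩ := mem_iUnion₂.mp h
      exact ⟨u, hu⟩
  obtain ⟨u, hu⟩ := this
  obtain ⟨ε, a, rfl, -⟩ := exists_cons_of_mem_stoppingWords hu
  exact List.cons_ne_nil ε a

/-- The ancestors of `a` and `b` in the previous generation are both suffixes of `b`, hence
comparable and, by induction, equal. Maximality of stopping cubes then settles the claim. -/
theorem eq_of_suffix_of_mem_generation {v : ℕ} {a b : List (Fin n → Bool)}
    (ha : a ∈ generation s t f Q₀ v) (hb : b ∈ generation s t f Q₀ v) (h : a <:+ b) : a = b := by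
  induction v generalizing a b with
  | zero => exact eq_of_suffix_of_mem_stoppingWords ha hb h
  | succ v ih =>
    obtain ⟨a', ha', haa⟩ := mem_iUnion₂.mp ha
    obtain ⟨b', hb', hbb⟩ := mem_iUnion₂.mp hb
    have hab : a' = b' := by
      rcases List.suffix_or_suffix_of_suffix (haa.1.trans h) hbb.1 with h1 | h1
      · exact ih ha' hb' h1
      · exact (ih hb' ha' h1).symm
    subst hab
    exact eq_of_suffix_of_mem_stoppingWords haa hbb h

theorem pairwise_disjoint_interior_generation (v : ℕ) :
    (generation s t f Q₀ v).Pairwise fun w w' =>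
      Disjoint (interior (Q₀.dyadic w).toSet) (interior (Q₀.dyadic w').toSet) :=
  fun _ ha _ hb hne => Q₀.disjoint_interior_dyadic
    (fun h => hne (eq_of_suffix_of_mem_generation ha hb h))
    (fun h => hne (eq_of_suffix_of_mem_generation hb ha h).symm)

theorem dyadicUnion_stoppingWords_subset (w : List (Fin n → Bool)) :
    dyadicUnion Q₀ (stoppingWords s t f Q₀ w) ⊆ (Q₀.dyadic w).toSet :=
  iUnion₂_subset fun _ h => Q₀.dyadic_subset_of_suffix h.1

theorem dyadicUnion_generation_succ (v : ℕ) :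
    dyadicUnion Q₀ (generation s t f Q₀ (v + 1)) =
      ⋃ w ∈ generation s t f Q₀ v, dyadicUnion Q₀ (stoppingWords s t f Q₀ w) := by
  ext x
  simp only [dyadicUnion, generation, mem_iUnion, exists_prop]
  constructor
  · rintro ⟨a, ⟨w, hw, ha⟩, hx⟩
    exact ⟨w, hw, a, ha, hx⟩
  · rintro ⟨w, hw, a, ha, hx⟩
    exact ⟨a, ⟨w, hw, ha⟩, hx⟩

/-- The stopping cubes do not overlap and each has at least 1 - t of its measure in the deviation
set, whose proportion is at most s. -/
theorem volume_dyadicUnion_stoppingWords_le (hf : Measurable f) (hs : 0 < s) (hst : s ≤ t)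
    (ht : 1 / 2 ≤ t) (hts : t < 1 - s) (w : List (Fin n → Bool)) :
    volume (dyadicUnion Q₀ (stoppingWords s t f Q₀ w)) ≤
      ENNReal.ofReal (s / (1 - t)) * volume (Q₀.dyadic w).toSet := by
  have ht1 : 0 < 1 - t := by linarith
  let S := stoppingWords s t f Q₀ w
  let E := medianDeviation s t f (Q₀.dyadic w)
  have hdisj : S.Pairwise (Function.onFun (AEDisjoint volume) fun w' =>
      E ∩ (Q₀.dyadic w').toSet) := fun a ha b hb hne =>
    (Cube.aedisjoint_of_disjoint_interior (Q₀.disjoint_interior_dyadic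
      (fun h => hne (eq_of_suffix_of_mem_stoppingWords ha hb h))
      (fun h => hne (eq_of_suffix_of_mem_stoppingWords hb ha h).symm))).mono
        inter_subset_right inter_subset_right
  have hsum := measure_biUnion₀ (to_countable S) hdisj fun w' _ =>
    ((measurableSet_medianDeviation hf).inter
      (Q₀.dyadic w').measurableSet_toSet).nullMeasurableSet
  have hE : ∑' w' : S, volume (E ∩ (Q₀.dyadic w').toSet) ≤
      ENNReal.ofReal s * volume (Q₀.dyadic w).toSet :=
    hsum.symm.le.trans ((measure_mono (iUnion₂_subset fun _ _ => inter_subset_left)).trans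
      (volume_medianDeviation_le hf hst hts hs))
  have hcube : ∀ w' : S, ENNReal.ofReal (1 - t) * volume (Q₀.dyadic w').toSet ≤
      volume (E ∩ (Q₀.dyadic w').toSet) := fun w' =>
    le_volume_medianDeviation_inter hf hst hts hs ht (Q₀.dyadic_subset_of_suffix w'.2.1) w'.2.2.1
  have hpos : ENNReal.ofReal (1 - t) ≠ 0 := (ENNReal.ofReal_pos.mpr ht1).ne'
  have htotal : ENNReal.ofReal (1 - t) * ∑' w' : S, volume (Q₀.dyadic w').toSet ≤
      ENNReal.ofReal s * volume (Q₀.dyadic w).toSet := by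
    rw [← ENNReal.tsum_mul_left]
    exact (ENNReal.tsum_le_tsum hcube).trans hE
  refine (measure_biUnion_le volume (to_countable S) _).trans ?_
  rw [ENNReal.ofReal_div_of_pos ht1, ENNReal.div_eq_inv_mul, mul_assoc,
    ← ENNReal.mul_le_iff_le_inv hpos ENNReal.ofReal_ne_top]
  exact htotal

/-- Descendants of the other cubes of generation v meet this one only in a null set. -/
theorem volume_dyadicUnion_generation_inter_le (hf : Measurable f) (hs : 0 < s) (hst : s ≤ t)
    (ht : 1 / 2 ≤ t) (hts : t < 1 - s) {v : ℕ} {w : List (Fin n → Bool)}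
    (hw : w ∈ generation s t f Q₀ v) :
    volume (dyadicUnion Q₀ (generation s t f Q₀ (v + 1)) ∩ (Q₀.dyadic w).toSet) ≤
      ENNReal.ofReal (s / (1 - t)) * volume (Q₀.dyadic w).toSet := by
  have hnull : volume (⋃ a ∈ generation s t f Q₀ v \ {w},
      (Q₀.dyadic a).toSet ∩ (Q₀.dyadic w).toSet) = 0 :=
    (measure_biUnion_null_iff (to_countable _)).mpr fun a ha =>
      Cube.aedisjoint_of_disjoint_interior
        (pairwise_disjoint_interior_generation v ha.1 hw ha.2)
  have hsub : dyadicUnion Q₀ (generation s t f Q₀ (v + 1)) ∩ (Q₀.dyadic w).toSet ⊆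
      dyadicUnion Q₀ (stoppingWords s t f Q₀ w) ∪
        ⋃ a ∈ generation s t f Q₀ v \ {w}, (Q₀.dyadic a).toSet ∩ (Q₀.dyadic w).toSet := by
    rintro x ⟨hx, hxw⟩
    rw [dyadicUnion_generation_succ] at hx
    obtain ⟨a, ha, hxa⟩ := mem_iUnion₂.mp hx
    by_cases haw : a = w
    · exact Or.inl (haw ▸ hxa)
    · exact Or.inr (mem_iUnion₂.mpr
        ⟨a, ⟨ha, haw⟩, dyadicUnion_stoppingWords_subset a hxa, hxw⟩)
  calc _ ≤ _ := (measure_mono hsub).trans (measure_union_le _ _)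
    _ = volume (dyadicUnion Q₀ (stoppingWords s t f Q₀ w)) := by rw [hnull, add_zero]
    _ ≤ _ := volume_dyadicUnion_stoppingWords_le hf hs hst ht hts w

theorem ofReal_abs_sub_le (a b c : ℝ) :
    ENNReal.ofReal |a - c| ≤ ENNReal.ofReal |a - b| + ENNReal.ofReal |b - c| := by
  rw [← ENNReal.ofReal_add (abs_nonneg _) (abs_nonneg _)]
  exact ENNReal.ofReal_le_ofReal (abs_sub_le a b c)

/-- The term 2 osc is carried along as credit: it pays for the distance from the median over `w` to
that over the parent of `w'`, which has not jumped. The stopping term pays for the step to the child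
and for the new credit. -/
theorem median_add_localOsc_le_of_mem_stoppingWords (hn : 1 ≤ n) (hf : Measurable f) (hs : 0 < s)
    (hs2 : s < 1 / 2) (hst : s ≤ t) (hts : t < 1 - s) (m : ℝ) {w w' : List (Fin n → Bool)}
    (h : w' ∈ stoppingWords s t f Q₀ w) :
    ENNReal.ofReal |median f t (Q₀.dyadic w') - m| + 2 * localOsc s f (Q₀.dyadic w') ≤
      ENNReal.ofReal |median f t (Q₀.dyadic w) - m| + 2 * localOsc s f (Q₀.dyadic w) +
        stoppingTerm s f Q₀ w' := by
  obtain ⟨ε, a, rfl, hwa⟩ := exists_cons_of_mem_stoppingWords h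
  have h1 : ENNReal.ofReal |median f t (Q₀.dyadic a) - median f t (Q₀.dyadic w)| ≤
      2 * localOsc s f (Q₀.dyadic w) :=
    not_lt.mp (h.2.2 a hwa (List.suffix_cons ε a) (List.cons_ne_self ε a).symm)
  have h2 := ofReal_abs_median_child_sub_le (f := f) hn hf hs hs2 hst hts (Q₀.dyadic a) ε
  have h3 : localOsc s f (Q₀.dyadic (ε :: a)) ≤
      ⨅ y ∈ (Q₀.dyadic (ε :: a)).toSet, sharpMaximal s (Q₀.dyadic (ε :: a)) f y :=
    le_iInf₂ fun y hy => localOsc_le_sharpMaximal subset_rfl hy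
  calc _ ≤ (ENNReal.ofReal |median f t (Q₀.dyadic (ε :: a)) - median f t (Q₀.dyadic a)| +
          (ENNReal.ofReal |median f t (Q₀.dyadic a) - median f t (Q₀.dyadic w)| +
            ENNReal.ofReal |median f t (Q₀.dyadic w) - m|)) +
          2 * localOsc s f (Q₀.dyadic (ε :: a)) := by
        gcongr
        exact (ofReal_abs_sub_le _ _ _).trans (by gcongr; exact ofReal_abs_sub_le _ _ _)
    _ ≤ (_ + (_ + ENNReal.ofReal |median f t (Q₀.dyadic w) - m|)) + _ :=
        add_le_add (add_le_add h2 (add_le_add h1 le_rfl)) (mul_le_mul_right h3 2)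
    _ = _ := by
        simp only [stoppingTerm, List.tail_cons, Cube.dyadic]
        ring

/-- Along a chain of dyadic cubes, either the median never jumps again or there is a first jump. -/
theorem forall_not_medianJump_or_exists_stoppingWord {w : ℕ → List (Fin n → Bool)}
    (hlen : ∀ k, (w k).length = k) (htail : ∀ k, (w (k + 1)).tail = w k) (k : ℕ) :
    (∀ l ≥ k, ¬ MedianJump s t f Q₀ (w k) (w l)) ∨
      ∃ l > k, w l ∈ stoppingWords s t f Q₀ (w k) := by
  classical
  have hsuff : ∀ {i j}, i ≤ j → w i <:+ w j := by
    intro i j hij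
    induction hij with
    | refl => exact List.suffix_rfl
    | step _ ih => exact ih.trans (htail _ ▸ List.tail_suffix _)
  by_cases hex : ∃ l, k ≤ l ∧ MedianJump s t f Q₀ (w k) (w l)
  · obtain ⟨hkl, hjump⟩ := Nat.find_spec hex
    have hmem : w (Nat.find hex) ∈ stoppingWords s t f Q₀ (w k) := by
      refine ⟨hsuff hkl, hjump, fun u hku hul hne hju => ?_⟩
      have hk := hku.length_le
      have hl := hul.length_le
      rw [hlen] at hk hl
      -- A suffix of a word of the chain is itself in the chain, so minimality of the first jump
      -- applies to it.
      have hu : u = w u.length :=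
        (List.suffix_of_suffix_length_le hul (hsuff hl) (hlen _).ge).eq_of_length (hlen _).symm
      have hlt : u.length < Nat.find hex :=
        lt_of_le_of_ne hl fun h => hne (hul.eq_of_length (by rw [h, hlen]))
      exact Nat.find_min hex hlt ⟨hk, hu ▸ hju⟩
    exact Or.inr ⟨_, lt_of_le_of_ne hkl fun h =>
      ne_of_mem_stoppingWords hmem (congrArg w h), hmem⟩
  · push Not at hex
    exact Or.inl hex

theorem abs_sub_median_le_of_tendsto (hn : 1 ≤ n) (hf : Measurable f) (hs : 0 < s)
    (hs2 : s < 1 / 2) (hst : s ≤ t) (hts : t < 1 - s) {x : Fin n → ℝ} (hx : x ∈ Q₀.toSet)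
    (hlim : ∀ w : ℕ → List (Fin n → Bool), (∀ k, (w k).length = k) →
      (∀ k, x ∈ (Q₀.dyadic (w k)).toSet) →
      Tendsto (fun k => median f t (Q₀.dyadic (w k))) atTop (𝓝 (f x))) :
    ENNReal.ofReal |f x - median f t Q₀| ≤ 4 * sharpMaximal s Q₀ f x +
      ∑' (v : ℕ) (w : generation s t f Q₀ v),
        (Q₀.dyadic w.1).toSet.indicator (fun _ => stoppingTerm s f Q₀ w.1) x := by
  obtain ⟨w, hw0, htail, hlen, hxw⟩ := Q₀.exists_dyadic_chain hx
  have hmed := hlim w hlen hxw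
  let T : ℕ → ℝ≥0∞ := fun v => ∑' w : generation s t f Q₀ v,
    (Q₀.dyadic w.1).toSet.indicator (fun _ => stoppingTerm s f Q₀ w.1) x
  let G : ℕ → ℝ≥0∞ := fun k =>
    ENNReal.ofReal |median f t (Q₀.dyadic (w k)) - median f t Q₀| +
      2 * localOsc s f (Q₀.dyadic (w k))
  change _ ≤ 4 * sharpMaximal s Q₀ f x + ∑' v, T v
  have hT : ∀ v k, w k ∈ generation s t f Q₀ v → stoppingTerm s f Q₀ (w k) ≤ T v := by
    intro v k hk
    have h := ENNReal.le_tsum (f := fun w : generation s t f Q₀ v =>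
      (Q₀.dyadic w.1).toSet.indicator (fun _ => stoppingTerm s f Q₀ w.1) x) ⟨w k, hk⟩
    rwa [indicator_of_mem (hxw k)] at h
  have hstep : ∀ k l, w l ∈ stoppingWords s t f Q₀ (w k) →
      G l ≤ G k + stoppingTerm s f Q₀ (w l) := fun k l h =>
    median_add_localOsc_le_of_mem_stoppingWords hn hf hs hs2 hst hts (median f t Q₀) h
  -- Twice the sharp maximal function would already suffice here.
  have hG0 : G 0 ≤ 4 * sharpMaximal s Q₀ f x := by
    simp only [G, hw0, Cube.dyadic, sub_self, abs_zero, ENNReal.ofReal_zero, zero_add]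
    exact mul_le_mul' (by norm_num) (localOsc_le_sharpMaximal subset_rfl hx)
  have hfinal : ∀ k, (∀ l ≥ k, ¬ MedianJump s t f Q₀ (w k) (w l)) →
      ENNReal.ofReal |f x - median f t Q₀| ≤ G k := by
    intro k hk
    have h1 : ENNReal.ofReal |f x - median f t (Q₀.dyadic (w k))| ≤
        2 * localOsc s f (Q₀.dyadic (w k)) :=
      le_of_tendsto (ENNReal.tendsto_ofReal (hmed.sub_const _).abs)
        ((eventually_ge_atTop k).mono fun l hl => not_lt.mp (hk l hl))
    refine (ofReal_abs_sub_le _ (median f t (Q₀.dyadic (w k))) _).trans ?_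
    rw [add_comm]
    exact add_le_add le_rfl h1
  -- If the bound fails, jumps never cease. The medians over the successive stopping cubes still
  -- converge to f x and obey the bound, a contradiction; no decay of the measure of the generations
  -- is needed.
  by_contra hcon
  have hnext : ∀ k V, G k ≤ 4 * sharpMaximal s Q₀ f x + ∑ v ∈ Finset.range V, T v →
      ∃ l > k, w l ∈ stoppingWords s t f Q₀ (w k) := by
    intro k V hk
    refine (forall_not_medianJump_or_exists_stoppingWord hlen htail k).resolve_left fun h => ?_
    exact hcon ((hfinal k h).trans (hk.trans (add_le_add le_rfl (ENNReal.sum_le_tsum _))))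
  have hreach : ∀ V : ℕ, ∃ k > V, w k ∈ generation s t f Q₀ V ∧
      G k ≤ 4 * sharpMaximal s Q₀ f x + ∑ v ∈ Finset.range (V + 1), T v := by
    intro V
    induction V with
    | zero =>
      obtain ⟨l, hl, hmem⟩ := hnext 0 0 (by simpa using hG0)
      have hgen : w l ∈ generation s t f Q₀ 0 := by
        rw [hw0] at hmem
        exact hmem
      refine ⟨l, hl, hgen, (hstep 0 l hmem).trans ?_⟩
      rw [Finset.sum_range_one]
      exact add_le_add hG0 (hT 0 l hgen)
    | succ V ih =>
      obtain ⟨k, hk, hkV, hGk⟩ := ih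
      obtain ⟨l, hl, hmem⟩ := hnext k (V + 1) hGk
      have hgen : w l ∈ generation s t f Q₀ (V + 1) := mem_iUnion₂.mpr ⟨w k, hkV, hmem⟩
      refine ⟨l, by omega, hgen, (hstep k l hmem).trans ?_⟩
      rw [Finset.sum_range_succ, ← add_assoc]
      exact add_le_add hGk (hT _ l hgen)
  choose k hk _ hGk using hreach
  have hk' : Tendsto k atTop atTop := tendsto_atTop_mono (fun V => (hk V).le) tendsto_id
  refine hcon (le_of_tendsto
    (ENNReal.tendsto_ofReal ((hmed.comp hk').sub_const (median f t Q₀)).abs)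
    (Eventually.of_forall fun V => ?_))
  exact le_self_add.trans ((hGk V).trans (add_le_add le_rfl (ENNReal.sum_le_tsum _)))

end Decomposition

/-! ### Invariance under changes on null sets -/

section Congruence

variable {n : ℕ} {f g : (Fin n → ℝ) → ℝ} {Q Q₀ : Cube n}

theorem volume_sep_congr (h : ∀ᵐ y, y ∈ Q.toSet → f y = g y) (p : ℝ → Prop) :
    volume {y | y ∈ Q.toSet ∧ p (f y)} = volume {y | y ∈ Q.toSet ∧ p (g y)} := by
  refine measure_congr ?_
  filter_upwards [h] with y hy
  exact propext (and_congr_right fun hQ => by rw [hy hQ])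

theorem median_congr_ae (t : ℝ) (h : ∀ᵐ y, y ∈ Q.toSet → f y = g y) :
    median f t Q = median g t Q := by
  unfold median
  simp only [fun M : ℝ => volume_sep_congr h fun r => r < M]

theorem localOsc_congr_ae (s : ℝ) (h : ∀ᵐ y, y ∈ Q.toSet → f y = g y) :
    localOsc s f Q = localOsc s g Q := by
  unfold localOsc
  simp only [fun (c : ℝ) (α : ℝ≥0) => volume_sep_congr h fun r => (α : ℝ) < |r - c|]

theorem sharpMaximal_congr_ae (s : ℝ) (h : ∀ᵐ y, y ∈ Q.toSet → f y = g y) :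
    sharpMaximal s Q f = sharpMaximal s Q g := by
  ext x
  refine iSup_congr fun R => iSup_congr fun _ => iSup_congr fun hR => ?_
  exact localOsc_congr_ae s (h.mono fun y hy hyR => hy (hR hyR))

end Congruence

/-- The generations `v = 1, 2, 3, …` of the decomposition are numbered here by `v = 0, 1, 2, …`.
The set `F v` consists of the (words that name the) dyadic subcubes `Q^v_j` of generation `v`, and
`I₂ v` is the subfamily over which the sum extends. No word in `F v` is empty, so each `Q^v_j` has
a dyadic parent among the dyadic subcubes of `Q₀`, named by `w.tail`. -/
theorem theorem1p1 (n : ℕ) (hn : 1 ≤ n) (Q₀ : Cube n) (f : (Fin n → ℝ) → ℝ)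
    (hf : AEMeasurable f (volume.restrict Q₀.toSet))
    (s t : ℝ) (hs0 : 0 < s) (hs : s < 1 / 2) (ht : 1 / 2 ≤ t) (hts : t < 1 - s) :
    ∃ F I₂ : ℕ → Set (List (Fin n → Bool)),
      (∀ v, ∀ w ∈ F v, w ≠ []) ∧
      (∀ v, I₂ v ⊆ F v) ∧
      -- (i) the pointwise bound
      (∀ᵐ x ∂(volume.restrict Q₀.toSet),
        ENNReal.ofReal |f x - median f t Q₀| ≤
          4 * sharpMaximal s Q₀ f x +
          ∑' (v : ℕ) (w : I₂ v),
            (Q₀.dyadic w.1).toSet.indicator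
              (fun _ =>
                10 * (n : ℝ≥0∞) *
                    (⨅ y ∈ (Q₀.dyadic w.1).toSet, sharpMaximal s (Q₀.dyadic w.1.tail) f y) +
                  2 * (⨅ y ∈ (Q₀.dyadic w.1).toSet, sharpMaximal s (Q₀.dyadic w.1) f y)) x) ∧
      -- (ii) the cubes of each generation do not overlap
      (∀ v, (F v).Pairwise fun w w' =>
        Disjoint (interior (Q₀.dyadic w).toSet) (interior (Q₀.dyadic w').toSet)) ∧
      -- (iii) the unions are nested
      (∀ v, dyadicUnion Q₀ (F (v + 1)) ⊆ dyadicUnion Q₀ (F v)) ∧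
      -- (iv) the next generation fills at most the proportion s / (1 - t) of each cube
      (∀ v, ∀ w ∈ F v,
        volume (dyadicUnion Q₀ (F (v + 1)) ∩ (Q₀.dyadic w).toSet) ≤
          ENNReal.ofReal (s / (1 - t)) * volume (Q₀.dyadic w).toSet) := by

  have hst : s ≤ t := by linarith
  obtain ⟨g, hg, hfg⟩ := hf
  have hQ₀ := Q₀.measurableSet_toSet
  have hae : ∀ w, ∀ᵐ y, y ∈ (Q₀.dyadic w).toSet → f y = g y := fun w =>
    ((ae_restrict_iff' hQ₀).mp hfg).mono fun y hy hyw =>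
      hy (Q₀.dyadic_subset_of_suffix List.nil_suffix hyw)
  have hsharp : ∀ w, sharpMaximal s (Q₀.dyadic w) f = sharpMaximal s (Q₀.dyadic w) g :=
    fun w => sharpMaximal_congr_ae s (hae w)
  -- The sum is allowed to run over every cube of each generation.
  refine ⟨generation s t g Q₀, generation s t g Q₀, fun v w h => ne_nil_of_mem_generation h,
    fun v => subset_rfl, ?_, pairwise_disjoint_interior_generation, fun v => ?_,
    fun v w hw => volume_dyadicUnion_generation_inter_le hg hs0 hst ht hts hw⟩
  · filter_upwards [ae_restrict_of_ae (ae_tendsto_median hg hst hts hs0), ae_restrict_mem hQ₀, hfg]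
      with x hx hxQ hfgx
    have h := abs_sub_median_le_of_tendsto hn hg hs0 hs hst hts hxQ (hx Q₀)
    rw [hfgx, median_congr_ae (Q := Q₀) t (hae []), show sharpMaximal s Q₀ f = sharpMaximal s Q₀ g from
      hsharp []]
    simp only [hsharp]
    exact h
  · rw [dyadicUnion_generation_succ]
    exact iUnion₂_mono fun w _ => dyadicUnion_stoppingWords_subset w
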